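/- Let $m\ge 2$, let $e_k(\mathbf y)$ be the $k$-th elementary symmetric polynomial in $\mathbf y=(y_1,\dots,y_m)$, and let $$Z(\mathbf y)=a_0e_0(\mathbf y)+a_1e_1(\mathbf y)+\cdots+a_me_m(\mathbf y),$$ where $a_0,\dots,a_m$ are nonnegative real numbers, not all zero. Write $E=\{1,\dots,m\}$ and $\mathbf y^S=\prod_{i\in S}y_i$, so that $Z(\mathbf y)=\sum_{S\subseteq E}\omega(S)\,\mathbf y^S$ with $\omega(S)=a_{|S|}$. For each $\mathbf y>\mathbf 0$ (all $y_i>0$) let $\mu_{\mathbf y}(S)=\omega(S)\,\mathbf y^S/Z(\mathbf y)$, a probability measure on the subsets of $E$, and for $e\in E$ let $X_e(S)=1$ if $e\in S$ and $X_e(S)=0$ otherwise. Say that $Z$ is Rayleigh if $\mathrm{Cov}(X_e,X_f)\le 0$ with respect to $\mu_{\mathbf y}$ for all $\mathbf y>\mathbf 0$ and all distinct $e,f\in E$. Put $$\Delta Z\{1,2\}=\frac{\partial Z}{\partial y_1}\frac{\partial Z}{\partial y_2}-\frac{\partial^2 Z}{\partial y_1\,\partial y_2}\,Z .$$ Then the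 following are equivalent: (a) $Z$ is Rayleigh; (b) the sequence $(a_k:0\le k\le m)$ is logarithmically concave with no internal zeros, that is, $a_k^2\ge a_{k-1}a_{k+1}$ for all $1\le k\le m-1$, and whenever $0\le i<j<k\le m$ and $a_ia_k\ne0$, also $a_j\neq 0$; (c) $\Delta Z\{1,2\}$ is a finite linear combination, with nonnegative coefficients, of Schur polynomials in the indeterminates $y_3,\dots,y_m$; (d) $\Delta Z\{1,2\}$ is a finite linear combination, with nonnegative coefficients, of monomial symmetric polynomials in the indeterminates $y_3,\dots,y_m$. -/

import Mathlib

open MvPolynomial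

noncomputable section

namespace RayleighPoly

variable {E : Type*} [Fintype E] [DecidableEq E]

/-- The partition function `Z(ω; y) = ∑_{S ⊆ E} ω(S) y^S` of a weight function `ω`,
as a polynomial in the indeterminates `y_e`, `e ∈ E`. -/
def partitionFunction (ω : Finset E → ℝ) : MvPolynomial E ℝ :=
  ∑ S : Finset E, C (ω S) * ∏ e ∈ S, X e

/-- The probability `μ_y(S) = ω(S) y^S / Z(ω; y)` of the subset `S`. -/
def prob (ω : Finset E → ℝ) (y : E → ℝ) (S : Finset E) : ℝ :=
  ω S * (∏ e ∈ S, y e) / eval y (partitionFunction ω)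

/-- The expectation `⟨V⟩` of a random variable `V` on the subsets of `E`, with respect
to the probability measure `μ_y`. -/
def expectation (ω : Finset E → ℝ) (y : E → ℝ) (V : Finset E → ℝ) : ℝ :=
  ∑ S : Finset E, V S * prob ω y S

/-- The covariance `⟨V W⟩ - ⟨V⟩ ⟨W⟩`. -/
def covariance (ω : Finset E → ℝ) (y : E → ℝ) (V W : Finset E → ℝ) : ℝ :=
  expectation ω y (fun S => V S * W S) - expectation ω y V * expectation ω y W

/-- The atomic random variable `X_e`: the indicator of the event `e ∈ S`. -/
def atomic (e : E) (S : Finset E) : ℝ := if e ∈ S then 1 else 0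

/-- The polynomial `Z` is Rayleigh: it is the partition function of a nonnegative weight
function `ω`, not identically zero, such that for every choice of positive parameters `y`
the atomic random variables of any two distinct elements are nonpositively correlated.
(The weight function `ω` is determined by `Z`.) -/
def IsRayleigh (Z : MvPolynomial E ℝ) : Prop :=
  ∃ ω : Finset E → ℝ, (∀ S, 0 ≤ ω S) ∧ (∃ S, ω S ≠ 0) ∧ Z = partitionFunction ω ∧
    ∀ y : E → ℝ, (∀ e, 0 < y e) → ∀ e f : E, e ≠ f →
      covariance ω y (atomic e) (atomic f) ≤ 0

/-- The Rayleigh difference `ΔZ{e,f} = Z_e Z_f - Z_{ef} Z`, subscripts denoting partial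
derivatives. -/
def rayleighDiff (Z : MvPolynomial E ℝ) (e f : E) : MvPolynomial E ℝ :=
  pderiv e Z * pderiv f Z - pderiv e (pderiv f Z) * Z

/-- The sequence `a_0, ..., a_m` has no internal zeros. -/
def NoInternalZeros (m : ℕ) (a : ℕ → ℝ) : Prop :=
  ∀ i j k : ℕ, i < j → j < k → k ≤ m → a i * a k ≠ 0 → a j ≠ 0

/-- The sequence `a_0, ..., a_m` is logarithmically concave. -/
def LogConcave (m : ℕ) (a : ℕ → ℝ) : Prop :=
  ∀ k : ℕ, 1 ≤ k → k + 1 ≤ m → a (k - 1) * a (k + 1) ≤ a k ^ 2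

/-- Semistandard Young tableaux of shape `μ` with entries in `{0, ..., n - 1}`. -/
abbrev BoundedSSYT (μ : YoungDiagram) (n : ℕ) : Type :=
  {T : SemistandardYoungTableau μ // ∀ c ∈ μ.cells, T c.1 c.2 < n}

instance (μ : YoungDiagram) (n : ℕ) : Finite (BoundedSSYT μ n) := by
  refine Finite.of_injective
    (fun (T : BoundedSSYT μ n) (c : μ.cells) => (⟨T.1 c.1.1 c.1.2, T.2 c.1 c.2⟩ : Fin n)) ?_
  intro T T' h
  apply Subtype.ext
  apply SemistandardYoungTableau.ext
  intro i j
  by_cases hc : (i, j) ∈ μ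
  · exact congrArg Fin.val (congrFun h ⟨(i, j), hc⟩)
  · rw [T.1.zeros hc, T'.1.zeros hc]

instance (μ : YoungDiagram) (n : ℕ) : Fintype (BoundedSSYT μ n) := Fintype.ofFinite _

/-- The Schur function of shape `μ` in `n` indeterminates: the sum, over the semistandard
tableaux `T` of shape `μ` with entries among the `n` indices, of the monomial
`∏_c x_{T(c)}`. -/
def schur (n : ℕ) (μ : YoungDiagram) : MvPolynomial (Fin n) ℝ :=
  ∑ T : BoundedSSYT μ n, ∏ c : μ.cells, X ⟨T.1 c.1.1 c.1.2, T.2 c.1 c.2⟩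

/-- `p` is a (finite) linear combination of the family `g` with nonnegative coefficients. -/
def IsNonnegCombination {σ ι : Type*} (g : ι → MvPolynomial σ ℝ) (p : MvPolynomial σ ℝ) :
    Prop :=
  ∃ c : ι →₀ ℝ, (∀ i, 0 ≤ c i) ∧ p = c.sum fun i r => r • g i

/-- The inclusion of the index set of the indeterminates `y_3, ..., y_m` into that of
`y_1, ..., y_m`; with indices counted from `0`, it is `i ↦ i + 2`. -/
def skipTwo (m : ℕ) (i : Fin (m - 2)) : Fin m := ⟨i.1 + 2, by omega⟩

/-- The symmetric polynomial `Z = a_0 e_0 + a_1 e_1 + ⋯ + a_m e_m` in `y_1, ..., y_m`. -/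
def exchangeable (m : ℕ) (a : ℕ → ℝ) : MvPolynomial (Fin m) ℝ :=
  ∑ k ∈ Finset.range (m + 1), C (a k) * esymm (Fin m) ℝ k

end RayleighPoly

end

/-!
Write `n = m - 2`, and let `A`, `B`, `C` be the sums `∑ a_k e_k`, `∑ a_{k+1} e_k`, `∑ a_{k+2} e_k`
in the last `n` indeterminates. Then `Z = A + (y_1 + y_2) B + y_1 y_2 C`, so the Rayleigh
difference is `B² - A C` (`rayleighDiff_exchangeable`), a symmetric polynomial in the last `n`
indeterminates. The four conditions are implied in a cycle.

* Pairing the terms `(p, q + 1)` and `(q, p + 1)` of the double sum for `B² - A C` gives the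
  expansion `∑_{q ≤ p} (a_{q+1} a_{p+1} - a_q a_{p+2}) (e_p e_q - e_{p+1} e_{q-1})`
  (`reducedDiff_eq`). The last factor is the Schur polynomial whose shape has columns of lengths
  `p` and `q`: semistandard tableaux of this shape correspond to ballot pairs of subsets
  (`schur_twoColumn_eq_ballotSum`), whose generating function satisfies the same recursion in the
  number of indeterminates as `e_p e_q - e_{p+1} e_{q-1}` (`ballotSum_eq`). The coefficients are
  nonnegative if `a` is logarithmically concave without internal zeros (`LogConcave.mul_le_mul`).
* Schur polynomials have nonnegative coefficients, and a symmetric polynomial with nonnegative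
  coefficients is a nonnegative combination of monomial symmetric polynomials
  (`isNonnegCombination_msymm`). The symmetry of Schur polynomials is not needed here, since
  `B² - A C` is visibly symmetric.
* The covariance of `X_e` and `X_f` is a negative multiple of the Rayleigh difference
  (`covariance_atomic`), which is nonnegative at positive points if it is a nonnegative combination
  of monomial symmetric polynomials. By exchangeability one pair of indices suffices.
* If `B² - A C` is nonnegative at all positive points, then it is so at the points with `j`
  coordinates equal to `t` and the others zero, so that its top coefficient in `t` is nonnegative
  (`coeff_diagonal_nonneg`). In degree `2 j` this is logarithmic concavity at `j + 1`. If `a` had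
  a gap between nonzero entries `a_i` and `a_{j+2}`, then `A C` would have degree `i + j`, more
  than that of `B²`, and a positive leading coefficient (`mul_eq_zero_of_gap`).
-/

open MvPolynomial

noncomputable section

namespace RayleighPoly

/-! ### Ballot pairs of subsets -/

section Ballot

variable {R : Type*} [CommRing R]

/-- A pair `(S, T)` of finite sets of natural numbers is a ballot pair if every initial segment
of `ℕ` contains at least as many elements of `S` as of `T`. -/
def Ballot (S T : Finset ℕ) : Prop :=
  ∀ v : ℕ, (T.filter (· < v)).card ≤ (S.filter (· < v)).card

/-- The elementary symmetric function of degree `p` in `x 0, ..., x (n - 1)`. The degree is an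
integer, so that the recursion in `n` has no boundary cases. -/
def elem (x : ℕ → R) (n : ℕ) (p : ℤ) : R :=
  ∑ S ∈ (Finset.range n).powerset, if (S.card : ℤ) = p then ∏ i ∈ S, x i else 0

open Classical in
/-- The generating function of the ballot pairs `(S, T)` of subsets of `{0, ..., n - 1}` with
`|S| = p` and `|T| = q`. -/
def ballotSum (x : ℕ → R) (n : ℕ) (p q : ℤ) : R :=
  ∑ S ∈ (Finset.range n).powerset, ∑ T ∈ (Finset.range n).powerset,
    if (S.card : ℤ) = p ∧ (T.card : ℤ) = q ∧ Ballot S T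
    then (∏ i ∈ S, x i) * ∏ i ∈ T, x i else 0

lemma elem_zero (x : ℕ → R) (p : ℤ) : elem x 0 p = if p = 0 then 1 else 0 := by
  simp [elem, eq_comm]

lemma elem_succ (x : ℕ → R) (n : ℕ) (p : ℤ) :
    elem x (n + 1) p = elem x n p + x n * elem x n (p - 1) := by
  unfold elem
  rw [Finset.range_add_one, Finset.sum_powerset_insert Finset.notMem_range_self, Finset.mul_sum]
  congr 1
  refine Finset.sum_congr rfl fun S hS => ?_
  have hn : n ∉ S := fun h => Finset.notMem_range_self (Finset.mem_powerset.1 hS h)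
  rw [Finset.card_insert_of_notMem hn, Finset.prod_insert hn]
  have : ((S.card + 1 : ℕ) : ℤ) = p ↔ (S.card : ℤ) = p - 1 := by push_cast; omega
  simp only [this]
  split_ifs <;> simp

lemma card_filter_insert {n : ℕ} {S : Finset ℕ} (hn : n ∉ S) (v : ℕ) :
    ((insert n S).filter (· < v)).card =
      (S.filter (· < v)).card + if n < v then 1 else 0 := by
  rw [Finset.filter_insert]
  split_ifs
  · rw [Finset.card_insert_of_notMem (by simp [hn])]
  · simp

lemma card_filter_lt_eq {n : ℕ} {S : Finset ℕ} (hS : S ⊆ Finset.range n) {v : ℕ} (hv : n ≤ v) :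
    (S.filter (· < v)).card = S.card := by
  congr 1
  exact Finset.filter_true_of_mem fun i hi => (Finset.mem_range.1 (hS hi)).trans_le hv

lemma Ballot.card_le {S T : Finset ℕ} {n : ℕ} (hS : S ⊆ Finset.range n)
    (hT : T ⊆ Finset.range n) (h : Ballot S T) : T.card ≤ S.card := by
  simpa [card_filter_lt_eq hS le_rfl, card_filter_lt_eq hT le_rfl] using h n

lemma ballot_insert_left {S T : Finset ℕ} {n : ℕ} (hS : S ⊆ Finset.range n)
    (hT : T ⊆ Finset.range n) : Ballot (insert n S) T ↔ Ballot S T := by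
  have hn : n ∉ S := fun h => Finset.notMem_range_self (hS h)
  constructor
  · intro h
    have key : ∀ v, v ≤ n → (T.filter (· < v)).card ≤ (S.filter (· < v)).card := by
      intro v hv
      have := h v
      rwa [card_filter_insert hn, if_neg (by omega)] at this
    intro v
    rcases le_total v n with hv | hv
    · exact key v hv
    · rw [card_filter_lt_eq hS hv, card_filter_lt_eq hT hv]
      simpa [card_filter_lt_eq hS le_rfl, card_filter_lt_eq hT le_rfl] using key n le_rfl
  · intro h v
    rw [card_filter_insert hn]
    exact (h v).trans (by omega)

lemma ballot_insert_right {S T : Finset ℕ} {n : ℕ} (hS : S ⊆ Finset.range n)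
    (hT : T ⊆ Finset.range n) : Ballot S (insert n T) ↔ Ballot S T ∧ T.card + 1 ≤ S.card := by
  have hn : n ∉ T := fun h => Finset.notMem_range_self (hT h)
  constructor
  · intro h
    refine ⟨fun v => ?_, ?_⟩
    · have := h v
      rw [card_filter_insert hn] at this
      omega
    · have := h (n + 1)
      rwa [card_filter_insert hn, card_filter_lt_eq hS (by omega), card_filter_lt_eq hT (by omega),
        if_pos (by omega)] at this
  · rintro ⟨h, hc⟩ v
    rw [card_filter_insert hn]
    split_ifs with hv
    · rwa [card_filter_lt_eq hS hv.le, card_filter_lt_eq hT hv.le]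
    · exact h v

lemma ballot_insert_both {S T : Finset ℕ} {n : ℕ} (hS : S ⊆ Finset.range n)
    (hT : T ⊆ Finset.range n) : Ballot (insert n S) (insert n T) ↔ Ballot S T := by
  have hnS : n ∉ S := fun h => Finset.notMem_range_self (hS h)
  have hnT : n ∉ T := fun h => Finset.notMem_range_self (hT h)
  refine forall_congr' fun v => ?_
  rw [card_filter_insert hnS, card_filter_insert hnT]
  omega

lemma ballotSum_eq_zero (x : ℕ → R) (n : ℕ) {p q : ℤ} (h : p < q) : ballotSum x n p q = 0 := by
  refine Finset.sum_eq_zero fun S hS => Finset.sum_eq_zero fun T hT => if_neg ?_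
  rintro ⟨hp, hq, hb⟩
  have := hb.card_le (Finset.mem_powerset.1 hS) (Finset.mem_powerset.1 hT)
  omega

lemma ballotSum_succ (x : ℕ → R) (n : ℕ) {p q : ℤ} (h : q ≤ p) :
    ballotSum x (n + 1) p q = ballotSum x n p q +
      x n * (ballotSum x n (p - 1) q + ballotSum x n p (q - 1)) +
      x n ^ 2 * ballotSum x n (p - 1) (q - 1) := by
  classical
  unfold ballotSum
  simp only [Finset.range_add_one, Finset.sum_powerset_insert Finset.notMem_range_self]
  simp only [mul_add, Finset.mul_sum, ← Finset.sum_add_distrib]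
  refine Finset.sum_congr rfl fun S hS => Finset.sum_congr rfl fun T hT => ?_
  rw [Finset.mem_powerset] at hS hT
  have hnS : n ∉ S := fun h => Finset.notMem_range_self (hS h)
  have hnT : n ∉ T := fun h => Finset.notMem_range_self (hT h)
  rw [Finset.card_insert_of_notMem hnS, Finset.prod_insert hnS,
    Finset.card_insert_of_notMem hnT, Finset.prod_insert hnT,
    ballot_insert_left hS hT, ballot_insert_right hS hT, ballot_insert_both hS hT]
  have h1 : ((S.card + 1 : ℕ) : ℤ) = p ↔ (S.card : ℤ) = p - 1 := by push_cast; omega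
  have h2 : ((T.card + 1 : ℕ) : ℤ) = q ↔ (T.card : ℤ) = q - 1 := by push_cast; omega
  have h3 : ((S.card : ℤ) = p ∧ (T.card : ℤ) = q - 1 ∧ Ballot S T ∧ T.card + 1 ≤ S.card) ↔
      ((S.card : ℤ) = p ∧ (T.card : ℤ) = q - 1 ∧ Ballot S T) := by
    constructor
    · tauto
    · rintro ⟨hp, hq, hb⟩
      exact ⟨hp, hq, hb, by omega⟩
  simp only [h1, h2, h3, mul_ite, mul_zero]
  have e : ∀ s t : R, x n * s * (x n * t) = x n ^ 2 * (s * t) := fun s t => by ring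
  have e' : ∀ s t : R, s * (x n * t) = x n * (s * t) := fun s t => by ring
  rw [e, e', mul_assoc]
  ring

/-- The dual Jacobi–Trudi identity for two columns. Both sides satisfy the same recursion
in `n`, whose terms stay in the range `q ≤ p + 1` if `q ≤ p`. -/
theorem ballotSum_eq (x : ℕ → R) (n : ℕ) {p q : ℤ} (h : q ≤ p + 1) :
    ballotSum x n p q = elem x n p * elem x n q - elem x n (p + 1) * elem x n (q - 1) := by
  induction n generalizing p q with
  | zero =>
    have h0 : Ballot ∅ ∅ := fun v => le_rfl
    simp only [ballotSum, elem_zero, Finset.range_zero, Finset.powerset_empty,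
      Finset.sum_singleton, h0]
    by_cases hp : p = 0 <;> by_cases hq : q = 0 <;> by_cases hp' : p + 1 = 0 <;>
      by_cases hq' : q - 1 = 0 <;> first | omega | simp [hp, hq, hp', hq', eq_comm]
  | succ n ih =>
    rcases h.lt_or_eq with h | rfl
    · have h : q ≤ p := by omega
      rw [ballotSum_succ x n h, ih (by omega), ih (by omega), ih (by omega), ih (by omega)]
      simp only [elem_succ]
      rw [show p - 1 + 1 = p by ring, show p + 1 - 1 = p by ring]
      ring
    -- For `q = p + 1` there are no ballot pairs, and the right-hand side is zero by symmetry.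
    · rw [ballotSum_eq_zero x _ (by omega)]
      rw [show p + 1 - 1 = p by ring]
      ring

/-- For the increasing enumerations `s` and `t` of two sets, the ballot condition compares the
entries in each row of the array with columns `s` and `t`. -/
lemma ballot_image_iff {p q : ℕ} (h : q ≤ p) {s : Fin p → ℕ} {t : Fin q → ℕ}
    (hs : StrictMono s) (ht : StrictMono t) :
    Ballot (Finset.univ.image s) (Finset.univ.image t) ↔ ∀ i, s (Fin.castLE h i) ≤ t i := by
  have cs : ∀ v, ((Finset.univ.image s).filter (· < v)).card =
      (Finset.univ.filter fun i => s i < v).card := fun v => by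
    rw [Finset.filter_image, Finset.card_image_of_injective _ hs.injective]
  have ct : ∀ v, ((Finset.univ.image t).filter (· < v)).card =
      (Finset.univ.filter fun i => t i < v).card := fun v => by
    rw [Finset.filter_image, Finset.card_image_of_injective _ ht.injective]
  constructor
  · intro hb i
    by_contra! hlt
    have h1 := hb (t i + 1)
    rw [cs, ct] at h1
    have h2 : (Finset.Iic i).card ≤ (Finset.univ.filter fun j => t j < t i + 1).card := by
      refine Finset.card_le_card fun j hj => ?_
      simpa [Nat.lt_succ_iff] using ht.monotone (Finset.mem_Iic.1 hj)
    have h3 : (Finset.univ.filter fun j => s j < t i + 1).card ≤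
        (Finset.Iio (Fin.castLE h i)).card := by
      refine Finset.card_le_card fun j hj => ?_
      rw [Finset.mem_filter] at hj
      exact Finset.mem_Iio.2 (hs.lt_iff_lt.1 (by omega))
    rw [Fin.card_Iic] at h2
    rw [Fin.card_Iio] at h3
    rw [Fin.val_castLE] at h3
    omega
  · intro hle v
    rw [cs, ct]
    refine Finset.card_le_card_of_injOn (Fin.castLE h) (fun i hi => ?_)
      (Fin.castLE_injective h).injOn
    simp only [Finset.coe_filter, Finset.mem_univ, true_and, Set.mem_ofPred_eq] at hi ⊢
    exact (hle i).trans_lt hi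

end Ballot

/-! ### Schur polynomials of two-column shapes -/

section TwoColumn

/-- The Young diagram with columns of lengths `p ≥ q`. -/
def twoColumn (p q : ℕ) (h : q ≤ p) : YoungDiagram where
  cells := Finset.range p ×ˢ {0} ∪ Finset.range q ×ˢ {1}
  isLowerSet := by
    rintro ⟨i, j⟩ ⟨i', j'⟩ hle hmem
    have h1 : i' ≤ i := hle.1
    have h2 : j' ≤ j := hle.2
    simp only [Finset.mem_coe, Finset.mem_union, Finset.mem_product, Finset.mem_range,
      Finset.mem_singleton] at hmem ⊢
    omega

variable {p q : ℕ} {h : q ≤ p}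

lemma mem_twoColumn {i j : ℕ} :
    (i, j) ∈ twoColumn p q h ↔ (j = 0 ∧ i < p) ∨ (j = 1 ∧ i < q) := by
  rw [← YoungDiagram.mem_cells]
  simp only [twoColumn, Finset.mem_union, Finset.mem_product, Finset.mem_range,
    Finset.mem_singleton]
  omega

lemma strictMono_column_zero (T : SemistandardYoungTableau (twoColumn p q h)) :
    StrictMono fun i : Fin p => T i 0 :=
  fun _ b hab => T.col_strict hab (mem_twoColumn.2 (Or.inl ⟨rfl, b.2⟩))

lemma strictMono_column_one (T : SemistandardYoungTableau (twoColumn p q h)) :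
    StrictMono fun i : Fin q => T i 1 :=
  fun _ b hab => T.col_strict hab (mem_twoColumn.2 (Or.inr ⟨rfl, b.2⟩))

/-- The tableau with columns `s` and `t`. -/
def ofColumns {s : Fin p → ℕ} {t : Fin q → ℕ} (hs : StrictMono s) (ht : StrictMono t)
    (hst : ∀ i, s (Fin.castLE h i) ≤ t i) : SemistandardYoungTableau (twoColumn p q h) where
  entry i j :=
    if j = 0 then if hi : i < p then s ⟨i, hi⟩ else 0
    else if j = 1 then if hi : i < q then t ⟨i, hi⟩ else 0 else 0
  row_weak' := by
    intro i j₁ j₂ hj hmem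
    rcases mem_twoColumn.1 hmem with ⟨rfl, hi⟩ | ⟨rfl, hi⟩
    · omega
    · obtain rfl : j₁ = 0 := by omega
      simpa [hi, hi.trans_le h] using hst ⟨i, hi⟩
  col_strict' := by
    intro i₁ i₂ j hi hmem
    rcases mem_twoColumn.1 hmem with ⟨rfl, hi₂⟩ | ⟨rfl, hi₂⟩
    · simpa [hi₂, hi.trans hi₂] using hs (show (⟨i₁, hi.trans hi₂⟩ : Fin p) < ⟨i₂, hi₂⟩ from hi)
    · simpa [hi₂, hi.trans hi₂] using ht (show (⟨i₁, hi.trans hi₂⟩ : Fin q) < ⟨i₂, hi₂⟩ from hi)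
  zeros' := by
    intro i j hmem
    rw [mem_twoColumn] at hmem
    grind

lemma ofColumns_zero {s : Fin p → ℕ} {t : Fin q → ℕ} (hs : StrictMono s) (ht : StrictMono t)
    (hst : ∀ i, s (Fin.castLE h i) ≤ t i) (i : Fin p) : ofColumns hs ht hst i 0 = s i := by
  change (if (0 : ℕ) = 0 then if hi : (i : ℕ) < p then s ⟨i, hi⟩ else 0 else
    if (0 : ℕ) = 1 then if hi : (i : ℕ) < q then t ⟨i, hi⟩ else 0 else 0) = _
  simp

lemma ofColumns_one {s : Fin p → ℕ} {t : Fin q → ℕ} (hs : StrictMono s) (ht : StrictMono t)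
    (hst : ∀ i, s (Fin.castLE h i) ≤ t i) (i : Fin q) : ofColumns hs ht hst i 1 = t i := by
  change (if (1 : ℕ) = 0 then if hi : (i : ℕ) < p then s ⟨i, hi⟩ else 0 else
    if (1 : ℕ) = 1 then if hi : (i : ℕ) < q then t ⟨i, hi⟩ else 0 else 0) = _
  simp

lemma prod_twoColumn {R : Type*} [CommMonoid R] (f : ℕ × ℕ → R) :
    ∏ c ∈ (twoColumn p q h).cells, f c = (∏ i : Fin p, f (i, 0)) * ∏ i : Fin q, f (i, 1) := by
  rw [twoColumn, Finset.prod_union, Finset.prod_product, Finset.prod_product]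
  · simp only [Finset.prod_singleton]
    rw [Finset.prod_range (fun i => f (i, 0)), Finset.prod_range (fun i => f (i, 1))]
  · rw [Finset.disjoint_left]
    rintro ⟨i, j⟩ h0 h1
    simp only [Finset.mem_product, Finset.mem_singleton] at h0 h1
    omega

/-- The indeterminates of `MvPolynomial (Fin n) ℝ`, extended by zero to a sequence. -/
def indet (n : ℕ) (i : ℕ) : MvPolynomial (Fin n) ℝ := if hi : i < n then X ⟨i, hi⟩ else 0

lemma indet_val {n : ℕ} (i : Fin n) : indet n i = X i := by simp [indet]

/-- The columns of a semistandard tableau of two-column shape form a ballot pair, and every ballot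
pair arises in this way. -/
lemma schur_twoColumn_eq_ballotSum (n : ℕ) :
    schur n (twoColumn p q h) = ballotSum (indet n) n p q := by
  classical
  unfold schur ballotSum
  rw [← Finset.sum_product', ← Finset.sum_filter]
  refine Finset.sum_bij (fun T _ => (Finset.univ.image fun i : Fin p => T.1 i 0,
    Finset.univ.image fun i : Fin q => T.1 i 1)) ?_ ?_ ?_ ?_
  · rintro ⟨T, hT⟩ -
    simp only [Finset.mem_filter, Finset.mem_product, Finset.mem_powerset]
    refine ⟨⟨?_, ?_⟩, ?_, ?_, ?_⟩
    · intro v hv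
      obtain ⟨i, -, rfl⟩ := Finset.mem_image.1 hv
      exact Finset.mem_range.2 (hT (i, 0) (mem_twoColumn.2 (Or.inl ⟨rfl, i.2⟩)))
    · intro v hv
      obtain ⟨i, -, rfl⟩ := Finset.mem_image.1 hv
      exact Finset.mem_range.2 (hT (i, 1) (mem_twoColumn.2 (Or.inr ⟨rfl, i.2⟩)))
    · rw [Finset.card_image_of_injective _ (strictMono_column_zero T).injective]
      simp
    · rw [Finset.card_image_of_injective _ (strictMono_column_one T).injective]
      simp
    · rw [ballot_image_iff h (strictMono_column_zero T) (strictMono_column_one T)]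
      exact fun i => T.row_weak zero_lt_one (mem_twoColumn.2 (Or.inr ⟨rfl, i.2⟩))
  · rintro ⟨T, hT⟩ - ⟨T', hT'⟩ - heq
    obtain ⟨h0, h1⟩ := Prod.ext_iff.1 heq
    have e0 : (fun i : Fin p => T i 0) = fun i : Fin p => T' i 0 := by
      rw [← (strictMono_column_zero T).range_inj (strictMono_column_zero T')]
      simpa using congrArg (fun S : Finset ℕ => (S : Set ℕ)) h0
    have e1 : (fun i : Fin q => T i 1) = fun i : Fin q => T' i 1 := by
      rw [← (strictMono_column_one T).range_inj (strictMono_column_one T')]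
      simpa using congrArg (fun S : Finset ℕ => (S : Set ℕ)) h1
    apply Subtype.ext
    apply SemistandardYoungTableau.ext
    intro i j
    by_cases hc : (i, j) ∈ twoColumn p q h
    · rcases mem_twoColumn.1 hc with ⟨rfl, hi⟩ | ⟨rfl, hi⟩
      · exact congrFun e0 ⟨i, hi⟩
      · exact congrFun e1 ⟨i, hi⟩
    · exact (T.zeros hc).trans (T'.zeros hc).symm
  · rintro ⟨S, T⟩ hST
    simp only [Finset.mem_filter, Finset.mem_product, Finset.mem_powerset, Nat.cast_inj] at hST
    obtain ⟨⟨hS, hT⟩, hp, hq, hb⟩ := hST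
    have hs := (S.orderEmbOfFin hp).strictMono
    have ht := (T.orderEmbOfFin hq).strictMono
    have hSi : Finset.univ.image (S.orderEmbOfFin hp) = S := by
      rw [← Finset.coe_inj]; simp
    have hTi : Finset.univ.image (T.orderEmbOfFin hq) = T := by
      rw [← Finset.coe_inj]; simp
    have hst : ∀ i, S.orderEmbOfFin hp (Fin.castLE h i) ≤ T.orderEmbOfFin hq i := by
      rw [← ballot_image_iff h hs ht, hSi, hTi]
      exact hb
    refine ⟨⟨ofColumns hs ht hst, ?_⟩, Finset.mem_univ _, ?_⟩
    · rintro ⟨i, j⟩ hc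
      rcases mem_twoColumn.1 ((YoungDiagram.mem_cells _).1 hc) with ⟨rfl, hi⟩ | ⟨rfl, hi⟩
      · exact (ofColumns_zero hs ht hst ⟨i, hi⟩).trans_lt
          (Finset.mem_range.1 (hS (Finset.orderEmbOfFin_mem S hp ⟨i, hi⟩)))
      · exact (ofColumns_one hs ht hst ⟨i, hi⟩).trans_lt
          (Finset.mem_range.1 (hT (Finset.orderEmbOfFin_mem T hq ⟨i, hi⟩)))
    · simp only [ofColumns_zero, ofColumns_one]
      exact Prod.ext hSi hTi
  · rintro ⟨T, hT⟩ -
    rw [Finset.prod_image (strictMono_column_zero T).injective.injOn,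
      Finset.prod_image (strictMono_column_one T).injective.injOn,
      ← prod_twoColumn (h := h) (fun c => indet n (T c.1 c.2)),
      ← Finset.prod_coe_sort (twoColumn p q h).cells]
    exact Finset.prod_congr rfl fun (c : (twoColumn p q h).cells) _ =>
      (indet_val (⟨T c.1.1 c.1.2, hT c c.2⟩ : Fin n)).symm

lemma elem_indet (n k : ℕ) : elem (indet n) n k = esymm (Fin n) ℝ k := by
  unfold elem esymm
  rw [← Finset.sum_filter]
  have : (Finset.range n).powerset.filter (fun S => (S.card : ℤ) = k) =
      (Finset.powersetCard k (Finset.univ : Finset (Fin n))).map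
        (Finset.mapEmbedding Fin.valEmbedding).toEmbedding := by
    rw [← Finset.powersetCard_map, Fin.map_valEmbedding_univ]
    ext S
    simp [Finset.mem_powersetCard, Finset.subset_iff]
  rw [this, Finset.sum_map]
  refine Finset.sum_congr rfl fun S _ => ?_
  change ∏ i ∈ S.map Fin.valEmbedding, _ = _
  rw [Finset.prod_map]
  exact Finset.prod_congr rfl fun i _ => indet_val i

lemma elem_neg {R : Type*} [CommRing R] (x : ℕ → R) (n : ℕ) {p : ℤ} (hp : p < 0) :
    elem x n p = 0 :=
  Finset.sum_eq_zero fun S _ => if_neg (by omega)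

lemma schur_twoColumn_zero (n : ℕ) (h : 0 ≤ p) :
    schur n (twoColumn p 0 h) = esymm (Fin n) ℝ p := by
  rw [schur_twoColumn_eq_ballotSum, ballotSum_eq _ _ (by omega), elem_indet, elem_indet,
    elem_neg _ _ (by omega : ((0 : ℕ) : ℤ) - 1 < 0)]
  simp

lemma schur_twoColumn_succ (n : ℕ) (h : q + 1 ≤ p) :
    schur n (twoColumn p (q + 1) h) =
      esymm (Fin n) ℝ p * esymm (Fin n) ℝ (q + 1) -
        esymm (Fin n) ℝ (p + 1) * esymm (Fin n) ℝ q := by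
  rw [schur_twoColumn_eq_ballotSum, ballotSum_eq _ _ (by omega), elem_indet, elem_indet,
    show ((p : ℤ) + 1) = ((p + 1 : ℕ) : ℤ) by push_cast; rfl,
    show (((q + 1 : ℕ) : ℤ) - 1) = (q : ℤ) by push_cast; ring, elem_indet, elem_indet]

end TwoColumn

/-! ### Nonnegative combinations -/

section Cone

variable {σ τ ι : Type*} {g : ι → MvPolynomial σ ℝ} {p q : MvPolynomial σ ℝ}

lemma isNonnegCombination_zero (g : ι → MvPolynomial σ ℝ) : IsNonnegCombination g 0 :=
  ⟨0, fun _ => le_rfl, by simp⟩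

lemma isNonnegCombination_smul (g : ι → MvPolynomial σ ℝ) {r : ℝ} (hr : 0 ≤ r) (i : ι) :
    IsNonnegCombination g (r • g i) := by
  classical
  refine ⟨Finsupp.single i r, fun j => ?_, by simp⟩
  rw [Finsupp.single_apply]
  split_ifs <;> simp [hr]

lemma IsNonnegCombination.add (hp : IsNonnegCombination g p) (hq : IsNonnegCombination g q) :
    IsNonnegCombination g (p + q) := by
  classical
  obtain ⟨c, hc, rfl⟩ := hp
  obtain ⟨d, hd, rfl⟩ := hq
  refine ⟨c + d, fun i => add_nonneg (hc i) (hd i), ?_⟩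
  rw [Finsupp.sum_add_index']
  · exact fun i => zero_smul ℝ (g i)
  · exact fun i r s => add_smul r s (g i)

lemma isNonnegCombination_sum {κ : Type*} (s : Finset κ) (f : κ → MvPolynomial σ ℝ)
    (h : ∀ k ∈ s, IsNonnegCombination g (f k)) : IsNonnegCombination g (∑ k ∈ s, f k) :=
  Finset.sum_induction f _ (fun _ _ => IsNonnegCombination.add) (isNonnegCombination_zero g) h

lemma isNonnegCombination_rename_iff {f : σ → τ} (hf : Function.Injective f) :
    IsNonnegCombination (fun i => rename f (g i)) (rename f p) ↔ IsNonnegCombination g p := by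
  refine exists_congr fun c => and_congr_right fun _ => ?_
  have : (c.sum fun i r => r • rename f (g i)) = rename f (c.sum fun i r => r • g i) := by
    rw [Finsupp.sum, Finsupp.sum, map_sum]
    simp
  rw [this, (rename_injective f hf).eq_iff]

lemma IsNonnegCombination.coeff_nonneg (hp : IsNonnegCombination g p)
    (hg : ∀ i d, 0 ≤ coeff d (g i)) (d : σ →₀ ℕ) : 0 ≤ coeff d p := by
  obtain ⟨c, hc, rfl⟩ := hp
  rw [Finsupp.sum, coeff_sum]
  refine Finset.sum_nonneg fun i _ => ?_
  rw [coeff_smul]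
  exact mul_nonneg (hc i) (hg i d)

lemma IsNonnegCombination.eval_nonneg (hp : IsNonnegCombination g p) {y : σ → ℝ}
    (hg : ∀ i, 0 ≤ eval y (g i)) : 0 ≤ eval y p := by
  obtain ⟨c, hc, rfl⟩ := hp
  rw [Finsupp.sum, map_sum]
  refine Finset.sum_nonneg fun i _ => ?_
  rw [smul_eval]
  exact mul_nonneg (hc i) (hg i)

end Cone

/-! ### Symmetric polynomials with nonnegative coefficients -/

section Monomial

variable {n : ℕ}

lemma coeff_schur_nonneg (μ : YoungDiagram) (d : Fin n →₀ ℕ) : 0 ≤ coeff d (schur n μ) := by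
  unfold schur
  rw [coeff_sum]
  refine Finset.sum_nonneg fun T _ => ?_
  have : ∀ c : μ.cells, (X ⟨T.1 c.1.1 c.1.2, T.2 c.1 c.2⟩ : MvPolynomial (Fin n) ℝ) =
      monomial (Finsupp.single ⟨T.1 c.1.1 c.1.2, T.2 c.1 c.2⟩ 1) 1 := fun _ => rfl
  rw [Finset.prod_congr rfl fun c _ => this c, ← monomial_sum_one, coeff_monomial]
  split_ifs <;> simp

lemma eval_msymm_nonneg {d : ℕ} (μ : Nat.Partition d) {y : Fin n → ℝ} (hy : ∀ i, 0 < y i) :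
    0 ≤ eval y (msymm (Fin n) ℝ μ) := by
  rw [msymm, map_sum]
  refine Finset.sum_nonneg fun s _ => ?_
  rw [map_multiset_prod, Multiset.map_map]
  refine Multiset.prod_nonneg fun r hr => ?_
  obtain ⟨i, -, rfl⟩ := Multiset.mem_map.1 hr
  simpa using (hy i).le

/-- The partition formed by the nonzero exponents of a monomial. -/
def shape (d : Fin n →₀ ℕ) : Σ k : ℕ, Nat.Partition k :=
  ⟨Multiset.card d.toMultiset, Nat.Partition.ofSym ⟨d.toMultiset, rfl⟩⟩

lemma shape_eq_iff (d : Fin n →₀ ℕ) {k : ℕ} (μ : Nat.Partition k) :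
    shape d = ⟨k, μ⟩ ↔ ∃ h : Multiset.card d.toMultiset = k,
      Nat.Partition.ofSym (⟨d.toMultiset, h⟩ : Sym (Fin n) k) = μ := by
  constructor
  · intro h
    unfold shape at h
    obtain ⟨rfl, h⟩ := Sigma.mk.inj_iff.1 h
    exact ⟨rfl, eq_of_heq h⟩
  · rintro ⟨rfl, rfl⟩
    rfl

lemma parts_shape (d : Fin n →₀ ℕ) : (shape d).2.parts = d.support.val.map d := by
  change d.toMultiset.dedup.map (fun i => d.toMultiset.count i) = _
  simp only [Finsupp.count_toMultiset]
  rw [← Finsupp.toFinset_toMultiset, Multiset.toFinset_val]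

/-- Monomials of equal shape differ by a permutation of the indeterminates. -/
lemma exists_perm_of_shape_eq {d d' : Fin n →₀ ℕ} (h : shape d = shape d') :
    ∃ e : Equiv.Perm (Fin n), d' = d.mapDomain e := by
  have hparts : d.support.val.map d = d'.support.val.map d' := by
    rw [← parts_shape, ← parts_shape, h]
  have hpos : ∀ k ≠ 0, (Finset.univ.filter fun i => d i = k).card =
      (Finset.univ.filter fun i => d' i = k).card := by
    intro k hk
    have aux : ∀ f : Fin n →₀ ℕ, (f.support.val.map f).count k =
        (Finset.univ.filter fun i => f i = k).card := by
      intro f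
      rw [Multiset.count_map, ← Finset.filter_val, Finset.card_val]
      congr 1
      ext i
      simp only [Finset.mem_filter, Finsupp.mem_support_iff, Finset.mem_univ, true_and]
      constructor
      · rintro ⟨-, rfl⟩; rfl
      · rintro rfl; exact ⟨hk, rfl⟩
    rw [← aux, ← aux, hparts]
  have hzero : (Finset.univ.filter fun i => d i = 0).card =
      (Finset.univ.filter fun i => d' i = 0).card := by
    have hs : d.support.card = d'.support.card := by
      simpa using congrArg Multiset.card hparts
    have aux : ∀ f : Fin n →₀ ℕ, (Finset.univ.filter fun i => f i = 0) = f.supportᶜ := by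
      intro f
      ext i
      simp
    rw [aux, aux, Finset.card_compl, Finset.card_compl, hs]
  have hcard : ∀ k, Nonempty ({i // d i = k} ≃ {i // d' i = k}) := by
    intro k
    rw [← Fintype.card_eq, Fintype.card_subtype, Fintype.card_subtype]
    rcases eq_or_ne k 0 with rfl | hk
    · exact hzero
    · exact hpos k hk
  refine ⟨Equiv.ofFiberEquiv fun k => (hcard k).some, ?_⟩
  ext i
  obtain ⟨j, rfl⟩ := (Equiv.ofFiberEquiv fun k => (hcard k).some).surjective i
  rw [Finsupp.mapDomain_apply (Equiv.injective _)]
  exact Equiv.ofFiberEquiv_map _ _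

lemma coeff_msymm (d : Fin n →₀ ℕ) (μ : Σ k : ℕ, Nat.Partition k) [Decidable (shape d = μ)] :
    coeff d (msymm (Fin n) ℝ μ.2) = if shape d = μ then 1 else 0 := by
  obtain ⟨k, μ⟩ := μ
  have hmon : ∀ s : Multiset (Fin n),
      (s.map X).prod = (monomial s.toFinsupp 1 : MvPolynomial (Fin n) ℝ) := by
    intro s
    induction s using Multiset.induction_on with
    | empty => simp
    | cons i s ih =>
      rw [Multiset.map_cons, Multiset.prod_cons, ih, ← Multiset.singleton_add,
        Multiset.toFinsupp_add, Multiset.toFinsupp_singleton, X, monomial_mul, one_mul]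
  unfold msymm
  rw [coeff_sum]
  simp only [hmon, coeff_monomial]
  split_ifs with h
  · obtain ⟨hk, hμ⟩ := (shape_eq_iff d μ).1 h
    rw [Finset.sum_eq_single ⟨⟨d.toMultiset, hk⟩, hμ⟩]
    · rw [if_pos (Finsupp.toMultiset_toFinsupp d)]
    · rintro ⟨⟨s, hs⟩, hsμ⟩ - hne
      refine if_neg fun hd => hne ?_
      apply Subtype.ext
      apply Subtype.ext
      exact Multiset.toFinsupp_eq_iff.1 hd
    · exact fun hn => absurd (Finset.mem_univ _) hn
  · refine Finset.sum_eq_zero ?_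
    rintro ⟨⟨s, hs⟩, hsμ⟩ -
    refine if_neg fun hd => h ?_
    obtain rfl : s = d.toMultiset := Multiset.toFinsupp_eq_iff.1 hd
    exact (shape_eq_iff d μ).2 ⟨hs, hsμ⟩

/-- A symmetric polynomial with nonnegative coefficients is a nonnegative combination of monomial
symmetric polynomials, since its coefficients are constant on monomials of equal shape. -/
theorem isNonnegCombination_msymm {P : MvPolynomial (Fin n) ℝ} (hP : P.IsSymmetric)
    (h0 : ∀ d, 0 ≤ coeff d P) :
    IsNonnegCombination (fun μ : (Σ d : ℕ, Nat.Partition d) => msymm (Fin n) ℝ μ.2) P := by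
  classical
  have hc : ∀ d d', shape d = shape d' → coeff d P = coeff d' P := by
    intro d d' h
    obtain ⟨e, rfl⟩ := exists_perm_of_shape_eq h
    conv_rhs => rw [← hP e]
    rw [coeff_rename_mapDomain _ e.injective]
  have hex : ∃ c : (Σ k : ℕ, Nat.Partition k) → ℝ, ∀ d, c (shape d) = coeff d P := by
    refine ⟨fun μ => if h : ∃ d : Fin n →₀ ℕ, shape d = μ then coeff h.choose P else 0,
      fun d => ?_⟩
    have h : ∃ d' : Fin n →₀ ℕ, shape d' = shape d := ⟨d, rfl⟩
    simp only [dif_pos h]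
    exact hc _ _ h.choose_spec
  obtain ⟨c, hcs⟩ := hex
  have key : P = ∑ μ ∈ P.support.image shape, c μ • msymm (Fin n) ℝ μ.2 := by
    ext d
    rw [coeff_sum]
    simp only [coeff_smul, coeff_msymm, smul_eq_mul, mul_ite, mul_one, mul_zero]
    rw [Finset.sum_ite_eq]
    split_ifs with h
    · exact (hcs d).symm
    · exact notMem_support_iff.1 fun hd => h (Finset.mem_image_of_mem _ hd)
  rw [key]
  refine isNonnegCombination_sum _ _ fun μ hμ => ?_
  obtain ⟨d, -, rfl⟩ := Finset.mem_image.1 hμ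
  refine isNonnegCombination_smul (fun μ : (Σ d : ℕ, Nat.Partition d) => msymm (Fin n) ℝ μ.2) ?_ _
  rw [hcs]
  exact h0 d

end Monomial

/-! ### Elimination of two indeterminates -/

section Elimination

lemma esymm_fin_succ (n k : ℕ) : esymm (Fin (n + 1)) ℝ (k + 1) =
    rename Fin.succ (esymm (Fin n) ℝ (k + 1)) + X 0 * rename Fin.succ (esymm (Fin n) ℝ k) := by
  have h0 : (0 : Fin (n + 1)) ∉ (Finset.univ : Finset (Fin n)).map (Fin.succEmb n) := by
    simp
  have hpc : ∀ k, ∑ S ∈ Finset.powersetCard k ((Finset.univ : Finset (Fin n)).map (Fin.succEmb n)),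
      ∏ i ∈ S, (X i : MvPolynomial (Fin (n + 1)) ℝ) = rename Fin.succ (esymm (Fin n) ℝ k) := by
    intro k
    rw [Finset.powersetCard_map, Finset.sum_map, esymm, map_sum]
    refine Finset.sum_congr rfl fun S _ => ?_
    change ∏ i ∈ S.map (Fin.succEmb n), _ = _
    rw [Finset.prod_map, map_prod]
    simp
  have huniv : (Finset.univ : Finset (Fin (n + 1))) =
      insert 0 ((Finset.univ : Finset (Fin n)).map (Fin.succEmb n)) := by
    ext i
    refine Fin.cases ?_ (fun i => ?_) i <;> simp
  have hnot : ∀ S ∈ Finset.powersetCard k ((Finset.univ : Finset (Fin n)).map (Fin.succEmb n)),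
      (0 : Fin (n + 1)) ∉ S := fun S hS h => h0 ((Finset.mem_powersetCard.1 hS).1 h)
  rw [esymm, huniv, Finset.powersetCard_succ_insert h0, Finset.sum_union, hpc, Finset.sum_image]
  · rw [← hpc k, Finset.mul_sum]
    congr 1
    exact Finset.sum_congr rfl fun S hS => Finset.prod_insert (hnot S hS)
  · intro S hS T hT h
    rw [← Finset.erase_insert (hnot S hS), ← Finset.erase_insert (hnot T hT), h]
  · rw [Finset.disjoint_left]
    intro S hS hS'
    obtain ⟨T, -, rfl⟩ := Finset.mem_image.1 hS'
    exact h0 ((Finset.mem_powersetCard.1 hS).1 (Finset.mem_insert_self _ _))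

lemma esymm_fin_eq_zero (n : ℕ) : esymm (Fin n) ℝ (n + 1) = 0 := by
  rw [esymm, Finset.powersetCard_eq_empty.2 (by simp), Finset.sum_empty]

lemma exchangeable_succ (n : ℕ) (a : ℕ → ℝ) : exchangeable (n + 1) a =
    rename Fin.succ (exchangeable n a) +
      X 0 * rename Fin.succ (exchangeable n fun k => a (k + 1)) := by
  have h : exchangeable n a = ∑ k ∈ Finset.range (n + 1 + 1), C (a k) * esymm (Fin n) ℝ k := by
    rw [Finset.sum_range_succ _ (n + 1), esymm_fin_eq_zero, mul_zero, add_zero, exchangeable]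
  rw [h, exchangeable, exchangeable, Finset.sum_range_succ', Finset.sum_range_succ' _ (n + 1)]
  simp only [map_add, map_sum, map_mul, esymm_fin_succ, esymm_zero, map_one, rename_C,
    Finset.mul_sum, mul_add, Finset.sum_add_distrib]
  rw [add_right_comm]
  congr 1
  exact Finset.sum_congr rfl fun k _ => by ring

/-- The decomposition `Z = A + (y_1 + y_2) B + y_1 y_2 C`. -/
lemma exchangeable_add_two (n : ℕ) (a : ℕ → ℝ) : exchangeable (n + 2) a =
    rename (skipTwo (n + 2)) (exchangeable n a) +
      (X 0 + X 1) * rename (skipTwo (n + 2)) (exchangeable n fun k => a (k + 1)) +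
      X 0 * X 1 * rename (skipTwo (n + 2)) (exchangeable n fun k => a (k + 2)) := by
  have hr : ∀ P : MvPolynomial (Fin n) ℝ,
      rename Fin.succ (rename Fin.succ P) = rename (skipTwo (n + 2)) P := fun P => by
    rw [rename_rename]
    rfl
  rw [exchangeable_succ, exchangeable_succ, exchangeable_succ]
  simp only [map_add, map_mul, rename_X, hr, Fin.succ_zero_eq_one]
  ring

lemma pderiv_rename_of_notMem_range {σ τ : Type*} {f : σ → τ} {i : τ} (hi : i ∉ Set.range f)
    (P : MvPolynomial σ ℝ) : pderiv i (rename f P) = 0 := by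
  refine pderiv_eq_zero_of_notMem_vars fun h => hi ?_
  obtain ⟨j, -, rfl⟩ := mem_vars_rename f P h
  exact ⟨j, rfl⟩

/-- The polynomial `B² - A C`, where `A`, `B` and `C` are formed from the sequence `a` and its
first two shifts. It is the Rayleigh difference of the partition function of `a` in two further
indeterminates. -/
def reducedDiff (n : ℕ) (a : ℕ → ℝ) : MvPolynomial (Fin n) ℝ :=
  exchangeable n (fun k => a (k + 1)) ^ 2 - exchangeable n a * exchangeable n fun k => a (k + 2)

lemma rayleighDiff_exchangeable (n : ℕ) (a : ℕ → ℝ) :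
    rayleighDiff (exchangeable (n + 2) a) 0 1 =
      rename (skipTwo (n + 2)) (reducedDiff n a) := by
  have h0 : (0 : Fin (n + 2)) ∉ Set.range (skipTwo (n + 2)) := by
    rintro ⟨i, hi⟩
    simpa [skipTwo] using congrArg Fin.val hi
  have h1 : (1 : Fin (n + 2)) ∉ Set.range (skipTwo (n + 2)) := by
    rintro ⟨i, hi⟩
    simpa [skipTwo] using congrArg Fin.val hi
  have d0 := pderiv_rename_of_notMem_range h0
  have d1 := pderiv_rename_of_notMem_range h1
  have h01 : (0 : Fin (n + 2)) ≠ 1 := by simp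
  rw [rayleighDiff, exchangeable_add_two, reducedDiff]
  simp only [map_add, map_sub, map_mul, map_pow, Derivation.leibniz, d0, d1, pderiv_X_self,
    pderiv_X_of_ne h01, pderiv_X_of_ne h01.symm, smul_eq_mul]
  simp only [map_zero, mul_zero, mul_one, add_zero, zero_add, Derivation.map_one_eq_zero]
  ring

lemma skipTwo_injective (m : ℕ) : Function.Injective (skipTwo m) := by
  intro i j h
  have := congrArg Fin.val h
  simp only [skipTwo] at this
  exact Fin.ext (by omega)

lemma exchangeable_isSymmetric (m : ℕ) (a : ℕ → ℝ) : (exchangeable m a).IsSymmetric := by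
  intro e
  simp only [exchangeable, map_sum, map_mul, rename_C]
  exact Finset.sum_congr rfl fun k _ => by rw [rename_esymm]

lemma reducedDiff_isSymmetric (n : ℕ) (a : ℕ → ℝ) : (reducedDiff n a).IsSymmetric := by
  intro e
  simp only [reducedDiff, map_sub, map_mul, map_pow, exchangeable_isSymmetric n _ e]

end Elimination

/-! ### The Schur expansion -/

section Expansion

lemma sum_sum_range_eq {R : Type*} [AddCommMonoid R] (k : ℕ → ℕ → R) (N : ℕ) :
    ∑ p ∈ Finset.range N, ∑ q ∈ Finset.range N, k p q =
      ∑ p ∈ Finset.range N, (k p p + ∑ q ∈ Finset.range p, (k p q + k q p)) := by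
  induction N with
  | zero => simp
  | succ N ih =>
    simp only [Finset.sum_range_succ _ N, Finset.sum_add_distrib] at ih ⊢
    rw [ih]
    abel

/-- The off-diagonal terms `(p, q + 1)` and `(q, p + 1)` of a double sum are paired, which produces
the differences `e p * e (q + 1) - e (p + 1) * e q`. -/
lemma sum_mul_mul_eq {R : Type*} [CommRing R] (e : ℕ → R) (g : ℕ → ℕ → R) (n : ℕ)
    (hanti : ∀ p q, g q (p + 1) = -g p (q + 1)) (hdiag : ∀ p, g p (p + 1) = 0)
    (he : e (n + 1) = 0) :
    ∑ p ∈ Finset.range (n + 1), ∑ q ∈ Finset.range (n + 1), g p q * (e p * e q) =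
      ∑ p ∈ Finset.range (n + 1), (g p 0 * (e p * e 0) +
        ∑ q ∈ Finset.range p, g p (q + 1) * (e p * e (q + 1) - e (p + 1) * e q)) := by
  have h1 : ∀ p, ∑ q ∈ Finset.range (n + 1), g p q * (e p * e q) =
      g p 0 * (e p * e 0) + ∑ q ∈ Finset.range (n + 1), g p (q + 1) * (e p * e (q + 1)) := by
    intro p
    rw [Finset.sum_range_succ', Finset.sum_range_succ _ n, he]
    ring
  simp only [h1, Finset.sum_add_distrib]
  rw [sum_sum_range_eq]
  congr 1
  refine Finset.sum_congr rfl fun p _ => ?_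
  rw [hdiag, zero_mul, zero_add]
  refine Finset.sum_congr rfl fun q _ => ?_
  rw [hanti p q]
  ring

lemma reducedDiff_eq (n : ℕ) (a : ℕ → ℝ) : reducedDiff n a =
    ∑ p ∈ Finset.range (n + 1),
      ((a 1 * a (p + 1) - a 0 * a (p + 2)) • schur n (twoColumn p 0 p.zero_le) +
        ∑ q : Fin p, (a (q + 2) * a (p + 1) - a (q + 1) * a (p + 2)) •
          schur n (twoColumn p (q + 1) q.2)) := by
  have h := sum_mul_mul_eq (fun k => esymm (Fin n) ℝ k)
    (fun p q => C (a (q + 1) * a (p + 1) - a q * a (p + 2))) n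
    (fun p q => by rw [← C_neg]; congr 1; ring) (fun p => by rw [← C_0]; congr 1; ring)
    (esymm_fin_eq_zero n)
  have h' : reducedDiff n a = ∑ p ∈ Finset.range (n + 1), ∑ q ∈ Finset.range (n + 1),
      C (a (q + 1) * a (p + 1) - a q * a (p + 2)) * (esymm (Fin n) ℝ p * esymm (Fin n) ℝ q) := by
    rw [reducedDiff, sq, mul_comm (exchangeable n a)]
    simp only [exchangeable, Finset.sum_mul_sum, ← Finset.sum_sub_distrib]
    refine Finset.sum_congr rfl fun p _ => Finset.sum_congr rfl fun q _ => ?_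
    rw [C_sub, C_mul, C_mul]
    ring
  rw [h', h]
  refine Finset.sum_congr rfl fun p _ => ?_
  congr 1
  · rw [schur_twoColumn_zero, smul_eq_C_mul, esymm_zero, mul_one, zero_add]
  · rw [Finset.sum_range]
    refine Finset.sum_congr rfl fun q _ => ?_
    rw [schur_twoColumn_succ, smul_eq_C_mul]

variable {m : ℕ} {a : ℕ → ℝ}

/-- Logarithmic concavity without internal zeros extends to pairs of indices at any distance. -/
lemma LogConcave.mul_le_mul (ha : ∀ k ≤ m, 0 ≤ a k) (h : LogConcave m a)
    (hz : NoInternalZeros m a) {p q : ℕ} (hqp : q ≤ p) (hp : p + 2 ≤ m) :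
    a q * a (p + 2) ≤ a (q + 1) * a (p + 1) := by
  induction p, hqp using Nat.le_induction with
  | base =>
    have := h (q + 1) (by omega) (by omega)
    simpa [sq] using this
  | succ p hqp ih =>
    have ih := ih (by omega)
    have hlc : a (p + 1) * a (p + 3) ≤ a (p + 2) ^ 2 := h (p + 2) (by omega) (by omega)
    by_cases h0 : a q * a (p + 3) = 0
    · calc a q * a (p + 3) = 0 := h0
        _ ≤ _ := mul_nonneg (ha _ (by omega)) (ha _ (by omega))
    have h1 : 0 < a (p + 1) :=
      (ha _ (by omega)).lt_of_ne' (hz q (p + 1) (p + 3) (by omega) (by omega) hp h0)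
    have h2 : 0 < a (p + 2) :=
      (ha _ (by omega)).lt_of_ne' (hz q (p + 2) (p + 3) (by omega) (by omega) hp h0)
    have hq : 0 ≤ a (q + 1) := ha _ (by omega)
    have h3 : 0 ≤ a (p + 3) := ha _ (by omega)
    refine le_of_mul_le_mul_right ?_ (mul_pos h1 h2)
    calc a q * a (p + 3) * (a (p + 1) * a (p + 2))
        = (a q * a (p + 2)) * (a (p + 1) * a (p + 3)) := by ring
      _ ≤ (a (q + 1) * a (p + 1)) * a (p + 2) ^ 2 :=
        _root_.mul_le_mul ih hlc (mul_nonneg h1.le h3) (mul_nonneg hq h1.le)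
      _ = a (q + 1) * a (p + 2) * (a (p + 1) * a (p + 2)) := by ring

lemma isNonnegCombination_schur {n : ℕ} (ha : ∀ k ≤ n + 2, 0 ≤ a k) (h : LogConcave (n + 2) a)
    (hz : NoInternalZeros (n + 2) a) :
    IsNonnegCombination (fun μ => schur n μ) (reducedDiff n a) := by
  rw [reducedDiff_eq]
  refine isNonnegCombination_sum _ _ fun p hp => ?_
  rw [Finset.mem_range] at hp
  refine .add (isNonnegCombination_smul (fun μ => schur n μ) ?_ _)
    (isNonnegCombination_sum _ _ fun q _ =>
      isNonnegCombination_smul (fun μ => schur n μ) ?_ _)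
  · exact sub_nonneg.2 (h.mul_le_mul ha hz (Nat.zero_le p) (by omega))
  · exact sub_nonneg.2 (h.mul_le_mul ha hz (show (q : ℕ) + 1 ≤ p from q.2) (by omega))

end Expansion

/-! ### Covariance and the Rayleigh difference -/

section Covariance

variable {E : Type*}

lemma rayleighDiff_rename {Z : MvPolynomial E ℝ} (hZ : Z.IsSymmetric)
    (σ : Equiv.Perm E) (e f : E) :
    rayleighDiff Z (σ e) (σ f) = rename σ (rayleighDiff Z e f) := by
  have h : ∀ (e : E) (P : MvPolynomial E ℝ), pderiv (σ e) (rename σ P) = rename σ (pderiv e P) :=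
    fun e P => pderiv_rename σ.injective e P
  unfold rayleighDiff
  rw [map_sub, map_mul, map_mul, ← h, ← h, ← h, ← h, hZ σ]

variable [Fintype E]

lemma eval_partitionFunction (ω : Finset E → ℝ) (y : E → ℝ) :
    eval y (partitionFunction ω) = ∑ S : Finset E, ω S * ∏ e ∈ S, y e := by
  simp [partitionFunction, map_sum, map_prod]

lemma expectation_eq (ω : Finset E → ℝ) (y : E → ℝ) (V : Finset E → ℝ) :
    expectation ω y V =
      eval y (partitionFunction fun S => V S * ω S) / eval y (partitionFunction ω) := by
  rw [eval_partitionFunction _ y, Finset.sum_div, expectation]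
  refine Finset.sum_congr rfl fun S _ => ?_
  rw [prob]
  ring

lemma eval_partitionFunction_pos {ω : Finset E → ℝ} (h0 : ∀ S, 0 ≤ ω S) (h1 : ∃ S, ω S ≠ 0)
    {y : E → ℝ} (hy : ∀ e, 0 < y e) : 0 < eval y (partitionFunction ω) := by
  rw [eval_partitionFunction]
  obtain ⟨S, hS⟩ := h1
  have hp : ∀ S : Finset E, 0 < ∏ e ∈ S, y e := fun S => Finset.prod_pos fun e _ => hy e
  exact Finset.sum_pos' (fun S _ => mul_nonneg (h0 S) (hp S).le)
    ⟨S, Finset.mem_univ _, mul_pos ((h0 S).lt_of_ne' hS) (hp S)⟩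

variable [DecidableEq E]

lemma X_mul_pderiv_partitionFunction (ω : Finset E → ℝ) (e : E) :
    X e * pderiv e (partitionFunction ω) = partitionFunction fun S => atomic e S * ω S := by
  have hprod : ∀ S : Finset E, X e * pderiv e (∏ i ∈ S, (X i : MvPolynomial E ℝ)) =
      C (atomic e S) * ∏ i ∈ S, X i := by
    intro S
    induction S using Finset.induction_on with
    | empty => simp [atomic]
    | insert i S hi ih =>
      rw [Finset.prod_insert hi, Derivation.leibniz, smul_eq_mul, smul_eq_mul, mul_add,
        mul_left_comm, ih]
      by_cases h : i = e
      · subst h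
        simp [atomic, hi, mul_comm]
      · simp [atomic, pderiv_X_of_ne h, Ne.symm h, mul_left_comm]
  unfold partitionFunction
  rw [map_sum, Finset.mul_sum]
  refine Finset.sum_congr rfl fun S _ => ?_
  rw [pderiv_C_mul, mul_left_comm, hprod, C_mul]
  ring

/-- The covariance of two distinct atomic variables is a negative multiple of the Rayleigh
difference. -/
lemma covariance_atomic {ω : Finset E → ℝ} {y : E → ℝ} (hZ : eval y (partitionFunction ω) ≠ 0)
    {e f : E} (hef : e ≠ f) :
    covariance ω y (atomic e) (atomic f) =
      -(y e * y f / eval y (partitionFunction ω) ^ 2 *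
        eval y (rayleighDiff (partitionFunction ω) e f)) := by
  have h1 : ∀ e, eval y (partitionFunction fun S => atomic e S * ω S) =
      y e * eval y (pderiv e (partitionFunction ω)) := fun e => by
    rw [← X_mul_pderiv_partitionFunction, map_mul, eval_X]
  have h2 : eval y (partitionFunction fun S => atomic e S * atomic f S * ω S) =
      y e * y f * eval y (pderiv e (pderiv f (partitionFunction ω))) := by
    have : (partitionFunction fun S => atomic e S * atomic f S * ω S) =
        X e * (X f * pderiv e (pderiv f (partitionFunction ω))) := by
      simp only [mul_assoc]
      rw [← X_mul_pderiv_partitionFunction (fun S => atomic f S * ω S),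
        ← X_mul_pderiv_partitionFunction ω, Derivation.leibniz, pderiv_X_of_ne hef.symm]
      simp
    rw [this, map_mul, map_mul, eval_X, eval_X, mul_assoc]
  rw [covariance, expectation_eq, expectation_eq, expectation_eq, h1, h1, h2, rayleighDiff,
    map_sub, map_mul, map_mul]
  field_simp
  ring

lemma covariance_atomic_nonpos_iff {ω : Finset E → ℝ} (h0 : ∀ S, 0 ≤ ω S) (h1 : ∃ S, ω S ≠ 0)
    {y : E → ℝ} (hy : ∀ e, 0 < y e) {e f : E} (hef : e ≠ f) :
    covariance ω y (atomic e) (atomic f) ≤ 0 ↔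
      0 ≤ eval y (rayleighDiff (partitionFunction ω) e f) := by
  have hZ := eval_partitionFunction_pos h0 h1 hy
  rw [covariance_atomic hZ.ne' hef, neg_nonpos]
  exact mul_nonneg_iff_of_pos_left (div_pos (mul_pos (hy e) (hy f)) (pow_pos hZ 2))

lemma exchangeable_eq_partitionFunction (m : ℕ) (a : ℕ → ℝ) :
    exchangeable m a = partitionFunction fun S : Finset (Fin m) => a S.card := by
  unfold exchangeable partitionFunction
  rw [← Finset.powerset_univ, Finset.sum_powerset, Finset.card_univ, Fintype.card_fin]
  refine Finset.sum_congr rfl fun k _ => ?_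
  rw [esymm, Finset.mul_sum]
  refine Finset.sum_congr rfl fun S hS => ?_
  simp only [(Finset.mem_powersetCard.1 hS).2]

lemma isRayleigh_of_eval_nonneg {n : ℕ} {a : ℕ → ℝ} (ha : ∀ k ≤ n + 2, 0 ≤ a k)
    (ha0 : ∃ k ≤ n + 2, a k ≠ 0)
    (h : ∀ y : Fin (n + 2) → ℝ, (∀ e, 0 < y e) →
      0 ≤ eval y (rayleighDiff (exchangeable (n + 2) a) 0 1)) :
    IsRayleigh (exchangeable (n + 2) a) := by
  have hω : ∀ S : Finset (Fin (n + 2)), 0 ≤ a S.card := fun S =>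
    ha _ (by simpa using S.card_le_univ)
  have hω0 : ∃ S : Finset (Fin (n + 2)), a S.card ≠ 0 := by
    obtain ⟨k, hk, hak⟩ := ha0
    obtain ⟨S, -, hS⟩ := Finset.exists_subset_card_eq
      (show k ≤ (Finset.univ : Finset (Fin (n + 2))).card by simpa using hk)
    exact ⟨S, by rwa [hS]⟩
  refine ⟨fun S => a S.card, hω, hω0, exchangeable_eq_partitionFunction _ a,
    fun y hy e f hef => ?_⟩
  rw [covariance_atomic_nonpos_iff hω hω0 hy hef, ← exchangeable_eq_partitionFunction]
  -- Exchangeability reduces the pair `e`, `f` to the first two indices.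
  obtain ⟨σ, hσ⟩ : ∃ σ : Equiv.Perm (Fin (n + 2)), ∀ i : Fin 2, σ (![0, 1] i) = ![e, f] i := by
    refine Equiv.Perm.exists_extending_pair _ _ ?_ ?_
    · intro i j
      fin_cases i <;> fin_cases j <;> simp
    · intro i j
      fin_cases i <;> fin_cases j <;> simp [hef, hef.symm]
  obtain rfl : σ 0 = e := hσ 0
  obtain rfl : σ 1 = f := hσ 1
  rw [rayleighDiff_rename (exchangeable_isSymmetric _ a), eval_rename]
  exact h _ fun i => hy _

lemma IsRayleigh.eval_nonneg {n : ℕ} {a : ℕ → ℝ} (h : IsRayleigh (exchangeable (n + 2) a))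
    {x : Fin n → ℝ} (hx : ∀ i, 0 < x i) : 0 ≤ eval x (reducedDiff n a) := by
  obtain ⟨ω, h0, h1, hZ, hcov⟩ := h
  have hy : ∀ i, 0 < (Fin.cons 1 (Fin.cons 1 x : Fin (n + 1) → ℝ) : Fin (n + 2) → ℝ) i := by
    intro i
    refine Fin.cases ?_ (fun i => Fin.cases ?_ (fun i => ?_) i) i
    · simp
    · simp
    · simpa using hx i
  have := hcov _ hy 0 1 (by simp)
  rw [covariance_atomic_nonpos_iff h0 h1 hy (by simp), ← hZ, rayleighDiff_exchangeable,
    eval_rename] at this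
  exact this

end Covariance

/-! ### Nonnegativity of the Rayleigh difference forces logarithmic concavity -/

section Necessity

open Polynomial in
lemma coeff_nonneg_of_eval_nonneg {p : ℝ[X]} {d : ℕ} (hd : p.natDegree ≤ d)
    (h : ∀ t : ℝ, 0 < t → 0 ≤ p.eval t) : 0 ≤ p.coeff d := by
  rcases hd.lt_or_eq with hd | rfl
  · rw [coeff_eq_zero_of_natDegree_lt hd]
  by_contra! hlt
  rcases Nat.eq_zero_or_pos p.natDegree with h0 | h0
  · have := h 1 one_pos
    rw [eq_C_of_natDegree_eq_zero h0, Polynomial.eval_C] at this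
    rw [h0] at hlt
    linarith
  · have ht := p.tendsto_atBot_of_leadingCoeff_nonpos (natDegree_pos_iff_degree_pos.1 h0) hlt.le
    obtain ⟨t, ht1, ht2⟩ := ((Filter.eventually_gt_atTop 0).and
      (ht.eventually (Filter.eventually_lt_atBot 0))).exists
    exact absurd (h t ht1) (not_le.2 ht2)

lemma eval_nonneg_of_pos {n : ℕ} {P : MvPolynomial (Fin n) ℝ}
    (h : ∀ x : Fin n → ℝ, (∀ i, 0 < x i) → 0 ≤ eval x P) {x : Fin n → ℝ} (hx : ∀ i, 0 ≤ x i) :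
    0 ≤ eval x P := by
  have hc : Continuous fun ε : ℝ => eval (fun i => x i + ε) P :=
    (MvPolynomial.continuous_eval P).comp (by fun_prop)
  have ht : Filter.Tendsto (fun ε : ℝ => eval (fun i => x i + ε) P) (nhdsWithin 0 (Set.Ioi 0))
      (nhds (eval x P)) := by
    have := (hc.tendsto 0).mono_left (nhdsWithin_le_nhds (s := Set.Ioi (0 : ℝ)))
    simpa using this
  refine ge_of_tendsto ht ?_
  filter_upwards [self_mem_nhdsWithin] with ε hε
  exact h _ fun i => add_pos_of_nonneg_of_pos (hx i) hε

/-- The restriction of the polynomial `∑ a_k e_k` to the points with `j` coordinates equal to `t` and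
the others zero, as a polynomial in `t`. -/
def diagonal (j : ℕ) (a : ℕ → ℝ) : Polynomial ℝ :=
  ∑ k ∈ Finset.range (j + 1), Polynomial.monomial k (a k * j.choose k)

lemma coeff_diagonal (j : ℕ) (a : ℕ → ℝ) (k : ℕ) :
    (diagonal j a).coeff k = a k * j.choose k := by
  simp only [diagonal, Polynomial.finsetSum_coeff, Polynomial.coeff_monomial, Finset.sum_ite_eq',
    Finset.mem_range]
  split_ifs with h
  · rfl
  · rw [Nat.choose_eq_zero_of_lt (by omega), Nat.cast_zero, mul_zero]

lemma natDegree_diagonal_le {j i : ℕ} {a : ℕ → ℝ} (h : ∀ k, i < k → k ≤ j → a k = 0) :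
    (diagonal j a).natDegree ≤ i := by
  rw [Polynomial.natDegree_le_iff_coeff_eq_zero]
  intro k hk
  rw [coeff_diagonal]
  rcases le_or_gt k j with hkj | hkj
  · rw [h k hk hkj, zero_mul]
  · rw [Nat.choose_eq_zero_of_lt hkj, Nat.cast_zero, mul_zero]

lemma eval_esymm_indicator {n j : ℕ} (hj : j ≤ n) (t : ℝ) (k : ℕ) :
    eval (fun i : Fin n => if (i : ℕ) < j then t else 0) (esymm (Fin n) ℝ k) =
      j.choose k * t ^ k := by
  have hcard : (Finset.univ.filter fun i : Fin n => (i : ℕ) < j).card = j := by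
    rw [Fin.card_filter_val_lt, min_eq_right hj]
  rw [esymm, map_sum]
  simp only [map_prod, eval_X]
  rw [← Finset.sum_subset (Finset.powersetCard_mono
    (Finset.filter_subset (fun i : Fin n => (i : ℕ) < j) Finset.univ))]
  · rw [Finset.sum_congr rfl (g := fun _ => t ^ k), Finset.sum_const, Finset.card_powersetCard,
      hcard, nsmul_eq_mul]
    intro S hS
    rw [Finset.mem_powersetCard] at hS
    rw [← hS.2, ← Finset.prod_const]
    exact Finset.prod_congr rfl fun i hi => if_pos (Finset.mem_filter.1 (hS.1 hi)).2
  · intro S hS hS'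
    rw [Finset.mem_powersetCard] at hS hS'
    obtain ⟨i, hi, hi'⟩ := Finset.not_subset.1 fun h => hS' ⟨h, hS.2⟩
    refine Finset.prod_eq_zero hi (if_neg fun hlt => hi' ?_)
    exact Finset.mem_filter.2 ⟨Finset.mem_univ _, hlt⟩

lemma eval_exchangeable_indicator {n j : ℕ} (hj : j ≤ n) (a : ℕ → ℝ) (t : ℝ) :
    eval (fun i : Fin n => if (i : ℕ) < j then t else 0) (exchangeable n a) =
      (diagonal j a).eval t := by
  rw [exchangeable, map_sum, diagonal, Polynomial.eval_finsetSum]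
  simp only [map_mul, eval_C, eval_esymm_indicator hj, Polynomial.eval_monomial]
  symm
  have hsub : Finset.range (j + 1) ⊆ Finset.range (n + 1) :=
    Finset.range_subset_range.2 (by omega)
  rw [Finset.sum_congr rfl fun k _ => mul_assoc _ _ _]
  refine Finset.sum_subset hsub fun k _ hk => ?_
  rw [Nat.choose_eq_zero_of_lt (by simpa using hk)]
  simp

variable {n : ℕ} {a : ℕ → ℝ}

/-- On the diagonal of `j` indeterminates `B² - A C` is a univariate polynomial that is nonnegative
on the positive half-line, so its coefficient in any degree that bounds its degree is nonnegative. -/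
lemma coeff_diagonal_nonneg (h : ∀ x : Fin n → ℝ, (∀ i, 0 < x i) → 0 ≤ eval x (reducedDiff n a))
    {j : ℕ} (hj : j ≤ n) {d : ℕ}
    (hd : (diagonal j (fun k => a (k + 1)) * diagonal j (fun k => a (k + 1)) -
      diagonal j a * diagonal j fun k => a (k + 2)).natDegree ≤ d) :
    (diagonal j a * diagonal j fun k => a (k + 2)).coeff d ≤
      (diagonal j (fun k => a (k + 1)) * diagonal j fun k => a (k + 1)).coeff d := by
  rw [← sub_nonneg, ← Polynomial.coeff_sub]
  refine coeff_nonneg_of_eval_nonneg hd fun t ht => ?_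
  have := eval_nonneg_of_pos h (x := fun i : Fin n => if (i : ℕ) < j then t else 0)
    fun i => by split_ifs <;> simp [ht.le]
  rw [reducedDiff, map_sub, map_mul, map_pow, eval_exchangeable_indicator hj,
    eval_exchangeable_indicator hj, eval_exchangeable_indicator hj, sq] at this
  rwa [Polynomial.eval_sub, Polynomial.eval_mul, Polynomial.eval_mul]

lemma logConcave_of_eval_nonneg
    (h : ∀ x : Fin n → ℝ, (∀ i, 0 < x i) → 0 ≤ eval x (reducedDiff n a)) :
    LogConcave (n + 2) a := by
  intro k hk hkn
  obtain ⟨j, rfl⟩ := Nat.exists_eq_add_of_le' hk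
  have hdeg : ∀ b, (diagonal j b).natDegree ≤ j := fun b =>
    natDegree_diagonal_le fun k h1 h2 => by omega
  have := coeff_diagonal_nonneg h (j := j) (d := j + j) (by omega)
    ((Polynomial.natDegree_sub_le _ _).trans (max_le
      (Polynomial.natDegree_mul_le_of_le (hdeg _) (hdeg _))
      (Polynomial.natDegree_mul_le_of_le (hdeg _) (hdeg _))))
  rw [Polynomial.coeff_mul_add_eq_of_natDegree_le (hdeg _) (hdeg _),
    Polynomial.coeff_mul_add_eq_of_natDegree_le (hdeg _) (hdeg _)] at this
  simpa [coeff_diagonal, sq] using this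

/-- If `a` vanishes strictly between `i` and `k`, then on the diagonal of `k - 2` indeterminates
`A C` has degree at most `i + (k - 2)`, with coefficient `a i * a k * (k - 2).choose i` in that
degree, whereas the corresponding coefficient of `B²` is zero. -/
lemma mul_eq_zero_of_gap (ha : ∀ k ≤ n + 2, 0 ≤ a k)
    (h : ∀ x : Fin n → ℝ, (∀ i, 0 < x i) → 0 ≤ eval x (reducedDiff n a)) {i k : ℕ}
    (hik : i + 2 ≤ k) (hk : k ≤ n + 2) (hgap : ∀ l, i < l → l < k → a l = 0) : a i * a k = 0 := by
  obtain ⟨j, rfl⟩ : ∃ j, k = j + 2 := ⟨k - 2, by omega⟩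
  have hA : (diagonal j a).natDegree ≤ i :=
    natDegree_diagonal_le fun l h1 h2 => hgap l h1 (by omega)
  have hB : (diagonal j fun k => a (k + 1)).natDegree ≤ i :=
    natDegree_diagonal_le fun l h1 h2 => hgap (l + 1) (by omega) (by omega)
  have hC : (diagonal j fun k => a (k + 2)).natDegree ≤ j :=
    natDegree_diagonal_le fun l h1 h2 => by omega
  have hB' := hB.trans (show i ≤ j by omega)
  have := coeff_diagonal_nonneg h (j := j) (d := i + j) (by omega)
    ((Polynomial.natDegree_sub_le _ _).trans (max_le
      (Polynomial.natDegree_mul_le_of_le hB hB') (Polynomial.natDegree_mul_le_of_le hA hC)))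
  rw [Polynomial.coeff_mul_add_eq_of_natDegree_le hA hC,
    Polynomial.coeff_mul_add_eq_of_natDegree_le hB hB'] at this
  simp only [coeff_diagonal, hgap (i + 1) (by omega) (by omega), Nat.choose_self, Nat.cast_one,
    mul_one, zero_mul] at this
  have hch : (0 : ℝ) < j.choose i := by exact_mod_cast Nat.choose_pos (by omega)
  refine le_antisymm ?_ (mul_nonneg (ha _ (by omega)) (ha _ hk))
  refine nonpos_of_mul_nonpos_left ?_ hch
  linarith

lemma noInternalZeros_of_eval_nonneg (ha : ∀ k ≤ n + 2, 0 ≤ a k)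
    (h : ∀ x : Fin n → ℝ, (∀ i, 0 < x i) → 0 ≤ eval x (reducedDiff n a)) :
    NoInternalZeros (n + 2) a := by
  classical
  intro i j k hij hjk hk hne hj
  obtain ⟨hi0, hk0⟩ := mul_ne_zero_iff.1 hne
  -- The nearest nonzero entries to the left and to the right of `a j = 0` bound a gap.
  have hr : ∃ d, a (j + d) ≠ 0 := ⟨k - j, by rwa [Nat.add_sub_cancel' hjk.le]⟩
  have hl : ∃ d, a (j - d) ≠ 0 := ⟨j - i, by rwa [Nat.sub_sub_self hij.le]⟩
  have hr0 := Nat.find_spec hr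
  have hl0 := Nat.find_spec hl
  have hrk : Nat.find hr ≤ k - j := Nat.find_min' hr (by rwa [Nat.add_sub_cancel' hjk.le])
  have hli : Nat.find hl ≤ j - i := Nat.find_min' hl (by rwa [Nat.sub_sub_self hij.le])
  have hrpos : Nat.find hr ≠ 0 := fun h0 => hr0 (by rw [h0]; exact hj)
  have hlpos : Nat.find hl ≠ 0 := fun h0 => hl0 (by rw [h0]; exact hj)
  refine mul_ne_zero hl0 hr0 (mul_eq_zero_of_gap ha h (by omega) (by omega) fun l h1 h2 => ?_)
  rcases le_total l j with hlj | hlj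
  · have := Nat.find_min hl (m := j - l) (by omega)
    rwa [not_not, Nat.sub_sub_self hlj] at this
  · have := Nat.find_min hr (m := l - j) (by omega)
    rwa [not_not, Nat.add_sub_cancel' hlj] at this

end Necessity

end RayleighPoly

end

theorem proposition3p6 (m : ℕ) (hm : 2 ≤ m) (a : ℕ → ℝ)
    (ha : ∀ k ≤ m, 0 ≤ a k) (ha0 : ∃ k ≤ m, a k ≠ 0) :
    List.TFAE [
      RayleighPoly.IsRayleigh (RayleighPoly.exchangeable m a),
      RayleighPoly.LogConcave m a ∧ RayleighPoly.NoInternalZeros m a,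
      RayleighPoly.IsNonnegCombination
        (fun μ : YoungDiagram =>
          MvPolynomial.rename (RayleighPoly.skipTwo m) (RayleighPoly.schur (m - 2) μ))
        (RayleighPoly.rayleighDiff (RayleighPoly.exchangeable m a)
          ⟨0, by omega⟩ ⟨1, by omega⟩),
      RayleighPoly.IsNonnegCombination
        (fun μ : (Σ d : ℕ, Nat.Partition d) =>
          MvPolynomial.rename (RayleighPoly.skipTwo m)
            (MvPolynomial.msymm (Fin (m - 2)) ℝ μ.2))
        (RayleighPoly.rayleighDiff (RayleighPoly.exchangeable m a)
          ⟨0, by omega⟩ ⟨1, by omega⟩)] := by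
  obtain ⟨n, rfl⟩ := Nat.exists_eq_add_of_le' hm
  have hinj := RayleighPoly.skipTwo_injective (n + 2)
  have hdiff : RayleighPoly.rayleighDiff (RayleighPoly.exchangeable (n + 2) a)
      ⟨0, by omega⟩ ⟨1, by omega⟩ =
      MvPolynomial.rename (RayleighPoly.skipTwo (n + 2)) (RayleighPoly.reducedDiff n a) :=
    RayleighPoly.rayleighDiff_exchangeable n a
  rw [hdiff, RayleighPoly.isNonnegCombination_rename_iff hinj,
    RayleighPoly.isNonnegCombination_rename_iff hinj]
  tfae_have 1 → 2 := fun h =>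
    ⟨RayleighPoly.logConcave_of_eval_nonneg fun _ hx => h.eval_nonneg hx,
      RayleighPoly.noInternalZeros_of_eval_nonneg ha fun _ hx => h.eval_nonneg hx⟩
  tfae_have 2 → 3 := fun h => RayleighPoly.isNonnegCombination_schur ha h.1 h.2
  tfae_have 3 → 4 := fun h =>
    RayleighPoly.isNonnegCombination_msymm (RayleighPoly.reducedDiff_isSymmetric n a)
      (h.coeff_nonneg RayleighPoly.coeff_schur_nonneg)
  tfae_have 4 → 1 := by
    intro h
    refine RayleighPoly.isRayleigh_of_eval_nonneg ha ha0 fun y hy => ?_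
    rw [RayleighPoly.rayleighDiff_exchangeable, MvPolynomial.eval_rename]
    exact h.eval_nonneg fun μ => RayleighPoly.eval_msymm_nonneg μ.2 fun i => hy _
  tfae_finish
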